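/- Let $(R,\oplus,\odot)$ be a valuative semifield: a commutative semifield with additive identity written $\infty$, totally ordered with largest element $\infty$, such that $a\oplus b=\min(a,b)$ and $R^*=R\setminus\{\infty\}$ is a totally ordered group under $\odot$ (for example $\overline{\mathbb R}=\mathbb R\cup\{\infty\}$ with $\oplus=\min$, $\odot=+$). A valuated matroid $\mathcal M$ of rank $r$ on a finite set $E$ is a function $p:\binom{E}{r}\to R$, not identically $\infty$, such that for all $A,B\in\binom Er$ and $a\in A\setminus B$ there is $b\in B\setminus A$ with $p(A)\odot p(B)\ge p(A\cup b-a)\odot p(B\cup a-b)$. Its circuits are the vectors $\lambda\odot H(B,e)\in R^E$ with $\lambda\in R^*$, $p(B)\neq\infty$, $e\in E\setminus B$ and $H(B,e)_{e'}=p(B\cup e-e')/p(B)$ (where $p=\infty$ on sets of size other than $r$), and its set of vectors is the $R$-subsemimodule of $R^E$ generated by the circuits; $p$ is determined by the set of vectors up to a scalar in $R^*$. A homogeneous ideal $I\subseteq R[x_0,\dots,x_n]$ is a homogeneous tropical ideal if for every $d\ge 0$ its degree-$d$ part $I_d$ is the set of vectors of a valuated matroid $\mathcal M_d(I)$ on the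 set of monomials of degree $d$; its Hilbert function is $H_I(d)=\operatorname{rank}\mathcal M_d(I)$. An ideal $I\subseteq R[x_1,\dots,x_n]$, not necessarily homogeneous, is a tropical ideal if for every $d\ge0$ the set $I_{\le d}$ of its polynomials of degree at most $d$ is the set of vectors of a valuated matroid on the set of monomials of degree at most $d$. Theorem (Ascending chain condition). Let $n\ge 0$. 1. If $I\subseteq J$ are homogeneous tropical ideals in $R[x_0,\dots,x_n]$ with $H_I=H_J$, then $I=J$. 2. There is no infinite strictly ascending chain $I_1\subsetneq I_2\subsetneq I_3\subsetneq\cdots$ of homogeneous tropical ideals in $R[x_0,\dots,x_n]$. 3. There is no infinite strictly ascending chain $I_1\subsetneq I_2\subsetneq I_3\subsetneq\cdots$ of (not necessarily homogeneous) tropical ideals in $R[x_1,\dots,x_n]$. 4. On the other hand, tropical ideals need not be finitely generated: if $n\ge1$, there is a homogeneous tropical ideal in $R[x_0,\dots,x_n]$ that is not finitely generated as an ideal. -/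

import Mathlib

/-- A valuative semifield in tropical notation: the additive identity `0` of `R` plays the role
of `∞`, the unit `1` that of the tropical unit, tropical addition `+` is the minimum, and the
order is compatible with tropical multiplication `*`, so that the nonzero elements form a totally
ordered abelian group. (As `a = a + 0 = min a 0`, the element `0` is the largest element.) -/
class ValuativeSemifield (R : Type*) [Semifield R] [LinearOrder R] : Prop where
  add_eq_min : ∀ a b : R, a + b = min a b
  mul_le_mul_of_le : ∀ a b c : R, a ≤ b → c * a ≤ c * b

/-- A valuated matroid on the finite ground set `E` with values in `R`, given by its basis
valuation function `p` on the subsets of size `rank`; `p` is extended by `∞` (that is, `0 : R`)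
to the subsets of any other size. -/
structure ValuatedMatroid (E : Type*) [DecidableEq E] [Fintype E]
    (R : Type*) [Semifield R] [LinearOrder R] where
  rank : ℕ
  p : Finset E → R
  p_eq_zero : ∀ B : Finset E, B.card ≠ rank → p B = 0
  exists_basis : ∃ B : Finset E, B.card = rank ∧ p B ≠ 0
  exchange : ∀ A B : Finset E, A.card = rank → B.card = rank → ∀ a ∈ A \ B, ∃ b ∈ B \ A,
    p A * p B ≥ p (insert b (A.erase a)) * p (insert a (B.erase b))

namespace ValuatedMatroid

variable {E : Type*} [DecidableEq E] [Fintype E] {R : Type*} [Semifield R] [LinearOrder R]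

/-- A basis of the underlying matroid. -/
def IsBasis (M : ValuatedMatroid E R) (B : Finset E) : Prop := M.p B ≠ 0

/-- The valuated fundamental circuit `H(B,e)`, with coordinates `p (B ∪ e - e') / p B`. -/
def fundamentalCircuit (M : ValuatedMatroid E R) (B : Finset E) (e : E) : E → R :=
  fun e' => M.p ((insert e B).erase e') / M.p B

/-- The valuated circuits: nonzero multiples of the fundamental circuits. -/
def circuits (M : ValuatedMatroid E R) : Set (E → R) :=
  {H | ∃ (B : Finset E) (e : E) (c : R), M.IsBasis B ∧ e ∉ B ∧ c ≠ 0 ∧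
    H = c • M.fundamentalCircuit B e}

/-- The vectors: the subsemimodule of `R^E` generated by the valuated circuits. -/
def vectors (M : ValuatedMatroid E R) : Submodule R (E → R) := Submodule.span R M.circuits

end ValuatedMatroid

/-- The (exponents of the) monomials of degree `d` in `m` variables. -/
def monomialsOfDegree (m d : ℕ) : Finset (Fin m →₀ ℕ) := Finset.univ.finsuppAntidiag d

/-- The (exponents of the) monomials of degree at most `d` in `m` variables. -/
def monomialsOfDegreeLE (m d : ℕ) : Finset (Fin m →₀ ℕ) :=
  (Finset.range (d + 1)).biUnion (monomialsOfDegree m)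

section TropicalIdeals

variable {m : ℕ} {R : Type*} [Semifield R] [LinearOrder R]

/-- The polynomials in `I` all of whose monomials lie in `E` form, under the identification of
polynomials supported in `E` with elements of `R^E`, the set of vectors of `M`. -/
def IsVectorSetOn (I : Ideal (MvPolynomial (Fin m) R)) (E : Finset (Fin m →₀ ℕ))
    (M : ValuatedMatroid E R) : Prop :=
  ∀ f : MvPolynomial (Fin m) R, f.support ⊆ E →
    (f ∈ I ↔ (fun u : E => f.coeff (u : Fin m →₀ ℕ)) ∈ M.vectors)

/-- Homogeneous tropical ideals: homogeneous ideals such that each graded piece is the set of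
vectors of a valuated matroid on the monomials of that degree. -/
def IsHomogeneousTropicalIdeal (I : Ideal (MvPolynomial (Fin m) R)) : Prop :=
  (∀ f ∈ I, ∀ d : ℕ, MvPolynomial.homogeneousComponent d f ∈ I) ∧
    ∀ d : ℕ, ∃ M : ValuatedMatroid (monomialsOfDegree m d) R,
      IsVectorSetOn I (monomialsOfDegree m d) M

/-- (Affine, not necessarily homogeneous) tropical ideals: for each `d` the polynomials in `I` of
degree at most `d` are the set of vectors of a valuated matroid on the monomials of degree at
most `d`. -/
def IsTropicalIdeal (I : Ideal (MvPolynomial (Fin m) R)) : Prop :=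
  ∀ d : ℕ, ∃ M : ValuatedMatroid (monomialsOfDegreeLE m d) R,
    IsVectorSetOn I (monomialsOfDegreeLE m d) M

/-- The valuated matroid of the degree-`d` part of a homogeneous tropical ideal (unique up to a
global scalar, since a valuated matroid is determined by its vectors). -/
noncomputable def IsHomogeneousTropicalIdeal.matroid {I : Ideal (MvPolynomial (Fin m) R)}
    (hI : IsHomogeneousTropicalIdeal I) (d : ℕ) : ValuatedMatroid (monomialsOfDegree m d) R :=
  (hI.2 d).choose

/-- The Hilbert function of a homogeneous tropical ideal. -/
noncomputable def IsHomogeneousTropicalIdeal.hilbertFunction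
    {I : Ideal (MvPolynomial (Fin m) R)} (hI : IsHomogeneousTropicalIdeal I) : ℕ → ℕ :=
  fun d => (hI.matroid d).rank

end TropicalIdeals

/-!
The proof transports Gröbner theory to valuated matroids: ideals are compared through their
leading monomials, and a nested pair of tropical ideals is determined by combinatorial ranks.

**Rigidity of vectors.** In a valuative semifield nothing cancels, so the support of a vector of a
valuated matroid is a union of circuits of the underlying matroid, and conversely every circuit is
the support of a vector. Hence, if the vectors of `M` are vectors of `N`, the bases of `M` span `N`
and the bases of `N` are independent in `M`; for equal ranks, `M` and `N` have the same bases. By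
the valuated exchange axiom a vector supported on `B ∪ {e}`, for a basis `B`, is a multiple of the
fundamental circuit `H(B,e)`, and so `M` and `N` even have the same vectors
(`ValuatedMatroid.vectors_eq_of_le`). Applied in every degree, this shows that nested homogeneous
tropical ideals with the same Hilbert function agree.

**Ranks from leading terms.** For any total order of the ground set, the elements that are not
the largest element of the support of a vector form a basis
(`ValuatedMatroid.isBase_compl_leadingElements`). For the graded lexicographic order on monomials,
the leading elements of the degree `d` (or degree at most `d`) part of a tropical ideal are the
leading monomials of the whole ideal that lie in that degree, so nested tropical ideals with the
same leading monomials have the same ranks, and coincide. The leading monomials of an ascending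
chain of ideals form an ascending chain of upper sets in `ℕ^m`, which stops growing at some step by
Dickson's lemma (`exists_subset_of_isUpperSet`); this gives both ascending chain conditions.

**An ideal that is not finitely generated.** The polynomials such that in each degree the minimum
of the coefficients is attained twice form the ideal `pointIdeal` of the tropical point
`(1 : ... : 1)`. Its graded pieces are the vectors of uniform matroids of rank one, and in every
degree `D` it needs a new generator in order to contain `x_i ^ D + x_j ^ D`.
-/

open MvPolynomial ValuativeSemifield

/-! ### Valuative semifields -/

namespace ValuativeSemifield

variable {R : Type*} [Semifield R] [LinearOrder R] [ValuativeSemifield R]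

lemma le_zero (a : R) : a ≤ 0 := by
  have h := add_eq_min a 0
  rw [add_zero] at h
  exact h ▸ min_le_right a 0

lemma zero_le_iff {a : R} : 0 ≤ a ↔ a = 0 :=
  ⟨fun h => le_antisymm (le_zero a) h, fun h => h.ge⟩

lemma ne_zero_of_le {a b : R} (h : a ≤ b) (hb : b ≠ 0) : a ≠ 0 := by
  rintro rfl
  exact hb (zero_le_iff.1 h)

lemma add_eq_zero_iff {a b : R} : a + b = 0 ↔ a = 0 ∧ b = 0 := by
  constructor
  · intro h
    rw [add_eq_min] at h
    exact ⟨zero_le_iff.1 (h ▸ min_le_left a b), zero_le_iff.1 (h ▸ min_le_right a b)⟩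
  · rintro ⟨rfl, rfl⟩
    exact add_zero 0

end ValuativeSemifield

/-! ### The underlying matroid and the supports of vectors -/

namespace ValuatedMatroid

variable {E : Type*} [DecidableEq E] [Fintype E] {R : Type*} [Semifield R] [LinearOrder R]

lemma IsBasis.card_eq {M : ValuatedMatroid E R} {B : Finset E} (hB : M.IsBasis B) :
    B.card = M.rank := by
  by_contra h
  exact hB (M.p_eq_zero B h)

lemma fundamentalCircuit_self (M : ValuatedMatroid E R) {B : Finset E} {e : E}
    (hB : M.IsBasis B) (he : e ∉ B) : M.fundamentalCircuit B e e = 1 := by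
  simp only [fundamentalCircuit, Finset.erase_insert he]
  exact div_self hB

lemma fundamentalCircuit_ne_zero_iff (M : ValuatedMatroid E R) {B : Finset E} {e e' : E}
    (hB : M.IsBasis B) :
    M.fundamentalCircuit B e e' ≠ 0 ↔ M.IsBasis ((insert e B).erase e') := by
  have : M.p B ≠ 0 := hB
  simp [fundamentalCircuit, IsBasis, this]

lemma fundamentalCircuit_mem_vectors (M : ValuatedMatroid E R) {B : Finset E} {e : E}
    (hB : M.IsBasis B) (he : e ∉ B) : M.fundamentalCircuit B e ∈ M.vectors :=
  Submodule.subset_span ⟨B, e, 1, hB, he, one_ne_zero, (one_smul R _).symm⟩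

variable [ValuativeSemifield R]

/-- The underlying matroid of a valuated matroid: its bases are the sets at which the basis
valuation is finite. -/
def underlying (M : ValuatedMatroid E R) : Matroid E :=
  Matroid.ofIsBaseOfFinite (E := Set.univ) Set.finite_univ
    (fun X => ∃ B : Finset E, (B : Set E) = X ∧ M.IsBasis B)
    (by
      obtain ⟨B, -, hB⟩ := M.exists_basis
      exact ⟨B, B, rfl, hB⟩)
    (by
      rintro _ _ ⟨A, rfl, hA⟩ ⟨B, rfl, hB⟩ a ha
      have ha' : a ∈ A \ B := by simpa using ha
      obtain ⟨b, hb, h⟩ := M.exchange A B hA.card_eq hB.card_eq a ha'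
      refine ⟨b, by simpa using hb, insert b (A.erase a), by simp, ?_⟩
      exact left_ne_zero_of_mul (ne_zero_of_le h (mul_ne_zero hA hB)))
    (fun _ _ => Set.subset_univ _)

@[simp] lemma underlying_E (M : ValuatedMatroid E R) : M.underlying.E = Set.univ := rfl

lemma underlying_isBase_iff (M : ValuatedMatroid E R) (B : Finset E) :
    M.underlying.IsBase (B : Set E) ↔ M.IsBasis B := by
  constructor
  · rintro ⟨A, hAB, hA⟩
    rwa [← Finset.coe_injective hAB]
  · exact fun h => ⟨B, rfl, h⟩

/-- The support of a fundamental circuit is the fundamental circuit of the underlying matroid. -/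
lemma support_fundamentalCircuit (M : ValuatedMatroid E R) {B : Finset E} {e : E}
    (hB : M.IsBasis B) (he : e ∉ B) :
    Function.support (M.fundamentalCircuit B e) = M.underlying.fundCircuit e B := by
  have hb := (M.underlying_isBase_iff B).2 hB
  ext e'
  rw [Function.mem_support, M.fundamentalCircuit_ne_zero_iff hB,
    hb.indep.mem_fundCircuit_iff (by rw [hb.closure_eq]; trivial) (by simpa using he)]
  have hset : insert e (B : Set E) \ {e'} = (((insert e B).erase e' : Finset E) : Set E) := by simp
  rw [hset]
  constructor
  · exact fun h => ((M.underlying_isBase_iff _).2 h).indep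
  · intro h
    obtain ⟨X, ⟨A, rfl, hA⟩, hX⟩ := h.exists_isBase_superset
    have hX' : (insert e B).erase e' ⊆ A := by exact_mod_cast hX
    have hcard : A.card ≤ ((insert e B).erase e').card := by
      rw [hA.card_eq, ← hB.card_eq]
      have := Finset.pred_card_le_card_erase (s := insert e B) (a := e')
      rw [Finset.card_insert_of_notMem he] at this
      omega
    rwa [Finset.eq_of_subset_of_card_le hX' hcard]

lemma isCircuit_support_of_mem_circuits (M : ValuatedMatroid E R) {v : E → R}
    (hv : v ∈ M.circuits) : M.underlying.IsCircuit (Function.support v) := by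
  obtain ⟨B, e, c, hB, he, hc, rfl⟩ := hv
  have : Function.support (c • M.fundamentalCircuit B e)
      = Function.support (M.fundamentalCircuit B e) := by
    ext; simp [hc]
  rw [this, M.support_fundamentalCircuit hB he]
  exact ((M.underlying_isBase_iff B).2 hB).fundCircuit_isCircuit trivial (by simpa using he)

/-- Since nothing cancels in `R`, the support of a vector is a union of circuits. -/
lemma exists_isCircuit_of_mem_vectors (M : ValuatedMatroid E R) {v : E → R}
    (hv : v ∈ M.vectors) {e : E} (he : v e ≠ 0) :
    ∃ C, M.underlying.IsCircuit C ∧ e ∈ C ∧ C ⊆ Function.support v := by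
  induction hv using Submodule.span_induction with
  | mem v hv => exact ⟨_, M.isCircuit_support_of_mem_circuits hv, he, subset_rfl⟩
  | zero => exact absurd rfl he
  | add v w _ _ hv hw =>
    have hsub : ∀ x, v x ≠ 0 ∨ w x ≠ 0 → (v + w) x ≠ 0 := by
      intro x hx h
      have := add_eq_zero_iff.1 h
      tauto
    have : v e ≠ 0 ∨ w e ≠ 0 := by
      by_contra! h
      exact he (add_eq_zero_iff.2 h)
    rcases this with h | h
    · obtain ⟨C, hC, heC, hCv⟩ := hv h
      exact ⟨C, hC, heC, fun x hx => hsub x (Or.inl (hCv hx))⟩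
    · obtain ⟨C, hC, heC, hCv⟩ := hw h
      exact ⟨C, hC, heC, fun x hx => hsub x (Or.inr (hCv hx))⟩
  | smul c v _ hv =>
    have hc : c ≠ 0 ∧ v e ≠ 0 := by simpa using he
    obtain ⟨C, hC, heC, hCv⟩ := hv hc.2
    exact ⟨C, hC, heC, fun x hx => by simpa [hc.1] using hCv hx⟩

lemma support_fundamentalCircuit_subset (M : ValuatedMatroid E R) {B : Finset E} {e : E}
    (hB : M.IsBasis B) (he : e ∉ B) {x : E} (hx : M.fundamentalCircuit B e x ≠ 0) :
    x ∈ insert e B := by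
  have h : x ∈ M.underlying.fundCircuit e B := by
    rw [← M.support_fundamentalCircuit hB he]; exact hx
  simpa using M.underlying.fundCircuit_subset_insert e B h

/-! ### Vectors of a given support -/

/-- If two fundamental circuits have the same support, then the valuated exchange axiom, applied
to the bases obtained by removing `f` and `g`, admits only `f` as the exchanged element. -/
lemma exchange_of_support_eq (M : ValuatedMatroid E R) {A B : Finset E} {a b : E}
    (hA : M.IsBasis A) (ha : a ∉ A) (hB : M.IsBasis B) (hb : b ∉ B)
    (hsupp : Function.support (M.fundamentalCircuit A a) =
      Function.support (M.fundamentalCircuit B b))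
    {f g : E} (hf : M.fundamentalCircuit A a f ≠ 0) (hg : M.fundamentalCircuit A a g ≠ 0) :
    M.p ((insert a A).erase g) * M.p ((insert b B).erase f) ≤
      M.p ((insert a A).erase f) * M.p ((insert b B).erase g) := by
  have key : ∀ {x}, M.fundamentalCircuit A a x ≠ 0 ↔ M.fundamentalCircuit B b x ≠ 0 :=
    fun {x} => Set.ext_iff.1 hsupp x
  rcases eq_or_ne f g with rfl | hfg
  · exact le_rfl
  have hAf := (M.fundamentalCircuit_ne_zero_iff hA).1 hf
  have hBg := (M.fundamentalCircuit_ne_zero_iff hB).1 (key.1 hg)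
  have hfA := M.support_fundamentalCircuit_subset hA ha hf
  have hgA := M.support_fundamentalCircuit_subset hA ha hg
  have hgB := M.support_fundamentalCircuit_subset hB hb (key.1 hg)
  obtain ⟨x, hx, h⟩ := M.exchange _ _ hAf.card_eq hBg.card_eq g
    (Finset.mem_sdiff.2 ⟨Finset.mem_erase.2 ⟨hfg.symm, hgA⟩, Finset.notMem_erase _ _⟩)
  rw [Finset.mem_sdiff, Finset.mem_erase] at hx
  obtain ⟨⟨hxg, hxB⟩, hxA⟩ := hx
  rw [Finset.erase_right_comm (a := g), Finset.insert_erase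
    (Finset.mem_erase.2 ⟨hxg.symm, hgB⟩)] at h
  -- an element `x ≠ f` lies outside the common support, so exchanging it gives the value `0 = ∞`
  rcases eq_or_ne x f with rfl | hxf
  · rwa [Finset.erase_right_comm, Finset.insert_erase (Finset.mem_erase.2 ⟨hfg, hfA⟩)] at h
  · have hxA' : x ∉ insert a A := fun hm => hxA (Finset.mem_erase.2 ⟨hxf, hm⟩)
    have hzero : M.p ((insert b B).erase x) = 0 := by
      by_contra hne
      exact hxA' (M.support_fundamentalCircuit_subset hA ha
        (key.2 ((M.fundamentalCircuit_ne_zero_iff hB).2 hne)))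
    rw [hzero, mul_zero] at h
    rw [zero_le_iff.1 h]
    exact le_zero _

/-- A vector supported in `B ∪ {e}`, for a basis `B`, is a multiple of the fundamental circuit. -/
lemma eq_smul_fundamentalCircuit (M : ValuatedMatroid E R) {B : Finset E} {e : E}
    (hB : M.IsBasis B) (he : e ∉ B) {v : E → R} (hv : v ∈ M.vectors)
    (hsub : ∀ x, v x ≠ 0 → x ∈ insert e B) : v = v e • M.fundamentalCircuit B e := by
  induction hv using Submodule.span_induction with
  | mem v hv =>
    have hcirc := M.isCircuit_support_of_mem_circuits hv
    have hb := (M.underlying_isBase_iff B).2 hB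
    have hsupp : Function.support v = Function.support (M.fundamentalCircuit B e) := by
      rw [M.support_fundamentalCircuit hB he]
      exact hcirc.eq_fundCircuit_of_subset hb.indep fun x hx => by simpa using hsub x hx
    obtain ⟨A, a, c, hA, ha, hc, rfl⟩ := hv
    have hsmul : Function.support (c • M.fundamentalCircuit A a)
        = Function.support (M.fundamentalCircuit A a) := by
      ext; simp [hc]
    rw [hsmul] at hsupp
    have hBe : M.fundamentalCircuit B e e = 1 := M.fundamentalCircuit_self hB he
    have hAe : M.fundamentalCircuit A a e ≠ 0 := by
      rw [← Function.mem_support, hsupp, Function.mem_support, hBe]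
      exact one_ne_zero
    funext f
    simp only [Pi.smul_apply, smul_eq_mul, mul_assoc]
    congr 1
    by_cases hf : M.fundamentalCircuit A a f = 0
    · have : M.fundamentalCircuit B e f = 0 := by
        rw [← Function.notMem_support, ← hsupp, Function.notMem_support, hf]
      rw [hf, this, mul_zero]
    · have hle := le_antisymm (M.exchange_of_support_eq hA ha hB he hsupp hf hAe)
        (M.exchange_of_support_eq hA ha hB he hsupp hAe hf)
      have hpA : M.p A ≠ 0 := hA
      have hpB : M.p B ≠ 0 := hB
      rw [Finset.erase_insert he] at hle
      simp only [fundamentalCircuit]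
      field_simp
      rw [hle]
  | zero => simp
  | add v w _ _ hv hw =>
    have h1 := hv fun x hx => hsub x fun h => hx (add_eq_zero_iff.1 h).1
    have h2 := hw fun x hx => hsub x fun h => hx (add_eq_zero_iff.1 h).2
    rw [Pi.add_apply, add_smul, ← h1, ← h2]
  | smul c v _ hv =>
    rcases eq_or_ne c 0 with rfl | hc
    · simp
    · have h1 := hv fun x hx => hsub x (by simpa [hc] using hx)
      rw [Pi.smul_apply, smul_assoc, ← h1]

/-! ### Valuated matroids with nested sets of vectors -/

/-- If the vectors of `M` are vectors of `N`, then the bases of `M` span `N`. -/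
lemma subset_closure_of_vectors_le {M N : ValuatedMatroid E R} (h : M.vectors ≤ N.vectors)
    {B : Finset E} (hB : M.IsBasis B) : N.underlying.E ⊆ N.underlying.closure B := by
  intro e _
  by_cases he : e ∈ B
  · exact N.underlying.mem_closure_of_mem (by simpa using he)
  · obtain ⟨C, hC, heC, hCsub⟩ := N.exists_isCircuit_of_mem_vectors
      (h (M.fundamentalCircuit_mem_vectors hB he)) (e := e)
      (by rw [M.fundamentalCircuit_self hB he]; exact one_ne_zero)
    refine N.underlying.closure_subset_closure ?_ (hC.mem_closure_sdiff_singleton_of_mem heC)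
    rintro x ⟨hxC, hxe⟩
    have := M.support_fundamentalCircuit_subset hB he (hCsub hxC)
    simpa [show x ≠ e from hxe] using this

lemma isBasis_of_vectors_le {M N : ValuatedMatroid E R} (h : M.vectors ≤ N.vectors)
    (hrank : M.rank = N.rank) {B : Finset E} (hB : M.IsBasis B) : N.IsBasis B := by
  have hsp : N.underlying.Spanning (B : Set E) :=
    (Matroid.spanning_iff_ground_subset_closure (Set.subset_univ _)).2
      (subset_closure_of_vectors_le h hB)
  obtain ⟨_, ⟨B', rfl, hB'⟩, hsub⟩ := hsp.exists_isBase_subset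
  have hsub' : B' ⊆ B := by exact_mod_cast hsub
  rwa [← Finset.eq_of_subset_of_card_le hsub' (by rw [hB.card_eq, hB'.card_eq, hrank])]

/-- Every circuit of the underlying matroid is the support of a vector. -/
lemma exists_mem_vectors_support_eq (M : ValuatedMatroid E R) {C : Set E}
    (hC : M.underlying.IsCircuit C) : ∃ v ∈ M.vectors, Function.support v = C := by
  obtain ⟨e, he⟩ := hC.nonempty
  obtain ⟨_, ⟨B, rfl, hB⟩, hsub⟩ := (hC.sdiff_singleton_indep he).exists_isBase_superset
  have hb := (M.underlying_isBase_iff B).2 hB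
  have hCB : C ⊆ insert e (B : Set E) := by
    intro x hx
    by_cases hxe : x = e
    · exact Or.inl hxe
    · exact Or.inr (hsub ⟨hx, hxe⟩)
  have heB : e ∉ B := by
    intro h
    refine hC.not_indep (hb.indep.subset ?_)
    rwa [Set.insert_eq_of_mem (by simpa using h)] at hCB
  refine ⟨_, M.fundamentalCircuit_mem_vectors hB heB, ?_⟩
  rw [M.support_fundamentalCircuit hB heB]
  exact (hC.eq_fundCircuit_of_subset hb.indep hCB).symm

/-- A set is independent as soon as it contains the support of no nonzero vector. -/
lemma indep_of_forall_vectors (M : ValuatedMatroid E R) {X : Set E}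
    (h : ∀ v ∈ M.vectors, Function.support v ⊆ X → v = 0) : M.underlying.Indep X := by
  rw [Matroid.indep_iff_forall_subset_not_isCircuit (Set.subset_univ _)]
  intro C hCX hC
  obtain ⟨v, hv, rfl⟩ := M.exists_mem_vectors_support_eq hC
  have := hC.nonempty
  rw [h v hv hCX] at this
  simp at this

lemma eq_zero_of_support_subset_indep (M : ValuatedMatroid E R) {X : Set E}
    (hX : M.underlying.Indep X) {v : E → R} (hv : v ∈ M.vectors)
    (hsub : Function.support v ⊆ X) : v = 0 := by
  by_contra hne
  obtain ⟨e, he⟩ := Function.ne_iff.1 hne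
  obtain ⟨C, hC, -, hCv⟩ := M.exists_isCircuit_of_mem_vectors hv he
  exact hC.not_indep (hX.subset (hCv.trans hsub))

lemma isBasis_iff_of_vectors_le {M N : ValuatedMatroid E R} (h : M.vectors ≤ N.vectors)
    (hrank : M.rank = N.rank) {B : Finset E} : N.IsBasis B ↔ M.IsBasis B := by
  refine ⟨fun hB => ?_, isBasis_of_vectors_le h hrank⟩
  have hind : M.underlying.Indep (B : Set E) := M.indep_of_forall_vectors fun v hv hsub =>
    N.eq_zero_of_support_subset_indep ((N.underlying_isBase_iff B).2 hB).indep (h hv) hsub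
  obtain ⟨_, ⟨B', rfl, hB'⟩, hsub⟩ := hind.exists_isBase_superset
  have hsub' : B ⊆ B' := by exact_mod_cast hsub
  rwa [Finset.eq_of_subset_of_card_le hsub' (by rw [hB.card_eq, hB'.card_eq, hrank])]

/-- Valuated matroids of the same rank with nested sets of vectors have the same vectors: they
have the same bases, and then the same fundamental circuits, because a vector supported on a
fundamental circuit is determined up to scaling. -/
theorem vectors_eq_of_le {M N : ValuatedMatroid E R} (h : M.vectors ≤ N.vectors)
    (hrank : M.rank = N.rank) : M.vectors = N.vectors := by
  refine le_antisymm h (Submodule.span_le.2 ?_)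
  rintro _ ⟨B, e, c, hB, he, -, rfl⟩
  have hB' := (isBasis_iff_of_vectors_le h hrank).1 hB
  have hvec := M.fundamentalCircuit_mem_vectors hB' he
  have heq := N.eq_smul_fundamentalCircuit hB he (h hvec)
    fun x => M.support_fundamentalCircuit_subset hB' he
  rw [M.fundamentalCircuit_self hB' he, one_smul] at heq
  exact M.vectors.smul_mem c (heq ▸ hvec)

/-! ### Leading elements and the rank -/

/-- The elements of the ground set that are the largest element of the support of a nonzero
vector, with respect to the order pulled back along `φ`. -/
def leadingElements {S : Type*} [LinearOrder S] (M : ValuatedMatroid E R) (φ : E → S) : Set E :=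
  {e | ∃ v ∈ M.vectors, v e ≠ 0 ∧ ∀ x, v x ≠ 0 → φ x ≤ φ e}

/-- The elements that lead no vector form a basis (the one found by the greedy algorithm): a
circuit inside this set would have a leading element, and an element leading a vector lies in the
closure of smaller elements. -/
lemma isBase_compl_leadingElements {S : Type*} [LinearOrder S] (M : ValuatedMatroid E R)
    {φ : E → S} (hφ : Function.Injective φ) :
    M.underlying.IsBase (M.leadingElements φ)ᶜ := by
  have hind : M.underlying.Indep (M.leadingElements φ)ᶜ := by
    refine M.indep_of_forall_vectors fun v hv hsub => ?_
    by_contra hne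
    obtain ⟨e, he⟩ := Function.ne_iff.1 hne
    obtain ⟨m, hm, hmax⟩ := Set.exists_max_image (Function.support v) φ (Set.toFinite _) ⟨e, he⟩
    exact hsub hm ⟨v, hv, hm, hmax⟩
  refine hind.isBase_of_ground_subset_closure ?_
  have hwf : WellFounded (fun a b : E => φ a < φ b) :=
    Finite.wellFounded_of_trans_of_irrefl _
  intro e _
  induction e using hwf.induction with
  | _ e ih =>
    by_cases he : e ∈ M.leadingElements φ
    · obtain ⟨v, hv, hve, hmax⟩ := he
      obtain ⟨C, hC, heC, hCv⟩ := M.exists_isCircuit_of_mem_vectors hv hve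
      refine M.underlying.closure_subset_closure_of_subset_closure ?_
        (hC.mem_closure_sdiff_singleton_of_mem heC)
      rintro x ⟨hxC, hxe⟩
      exact ih x (lt_of_le_of_ne (hmax x (hCv hxC)) fun h => hxe (hφ h)) trivial
    · exact M.underlying.mem_closure_of_mem he (Set.subset_univ _)

lemma rank_eq_of_leadingElements_eq {S : Type*} [LinearOrder S] {M N : ValuatedMatroid E R}
    {φ : E → S} (hφ : Function.Injective φ)
    (h : M.leadingElements φ = N.leadingElements φ) : M.rank = N.rank := by
  obtain ⟨B, hBeq, hB⟩ := M.isBase_compl_leadingElements hφ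
  obtain ⟨B', hBeq', hB'⟩ := N.isBase_compl_leadingElements hφ
  rw [← hB.card_eq, ← hB'.card_eq, Finset.coe_injective (hBeq.trans (h ▸ hBeq'.symm))]

end ValuatedMatroid

/-! ### Leading monomials and ascending chains -/

lemma mem_monomialsOfDegree {m d : ℕ} {u : Fin m →₀ ℕ} :
    u ∈ monomialsOfDegree m d ↔ u.degree = d := by
  simp [monomialsOfDegree, Finset.mem_finsuppAntidiag, Finsupp.degree_eq_sum]

lemma mem_monomialsOfDegreeLE {m d : ℕ} {u : Fin m →₀ ℕ} :
    u ∈ monomialsOfDegreeLE m d ↔ u.degree ≤ d := by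
  simp [monomialsOfDegreeLE, mem_monomialsOfDegree]

section LeadingMonomials

variable {m : ℕ} {R : Type*} [Semifield R]

/-- Every element of `R^E` is the coefficient vector of a polynomial supported in `E`. -/
lemma exists_coeff_eq (E : Finset (Fin m →₀ ℕ)) (v : E → R) :
    ∃ f : MvPolynomial (Fin m) R, f.support ⊆ E ∧
      (fun u : E => f.coeff (u : Fin m →₀ ℕ)) = v := by
  classical
  have hcoeff : ∀ w : Fin m →₀ ℕ, (∑ u : E, monomial (u : Fin m →₀ ℕ) (v u)).coeff w =
      if h : w ∈ E then v ⟨w, h⟩ else 0 := by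
    intro w
    rw [coeff_sum]
    simp only [coeff_monomial]
    split_ifs with h
    · rw [Finset.sum_eq_single ⟨w, h⟩]
      · simp
      · intro b _ hb
        exact if_neg fun hbw => hb (Subtype.ext hbw)
      · simp
    · exact Finset.sum_eq_zero fun u _ => if_neg fun (huw : (u : Fin m →₀ ℕ) = w) => h (huw ▸ u.2)
  refine ⟨∑ u : E, monomial (u : Fin m →₀ ℕ) (v u), fun w hw => ?_, ?_⟩
  · by_contra h
    rw [mem_support_iff, hcoeff, dif_neg h] at hw
    exact hw rfl
  · funext u
    rw [hcoeff, dif_pos u.2]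

/-- The monomials (exponents) that are the largest monomial of some member of `I`, in the graded
lexicographic order. -/
def leadingMonomials (I : Ideal (MvPolynomial (Fin m) R)) : Set (Fin m →₀ ℕ) :=
  {u | ∃ f ∈ I, u ∈ f.support ∧ ∀ w ∈ f.support, toDegLex w ≤ toDegLex u}

lemma leadingMonomials_mono {I J : Ideal (MvPolynomial (Fin m) R)} (h : I ≤ J) :
    leadingMonomials I ⊆ leadingMonomials J :=
  fun _ ⟨f, hf, hu⟩ => ⟨f, h hf, hu⟩

lemma isUpperSet_leadingMonomials (I : Ideal (MvPolynomial (Fin m) R)) :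
    IsUpperSet (leadingMonomials I) := by
  rintro u w huw ⟨f, hf, hu, hmax⟩
  obtain ⟨s, rfl⟩ := exists_add_of_le huw
  refine ⟨monomial s 1 * f, I.mul_mem_left _ hf, ?_, fun t ht => ?_⟩
  · rw [mem_support_iff, add_comm, coeff_monomial_mul, one_mul]
    exact mem_support_iff.1 hu
  · rw [mem_support_iff, coeff_monomial_mul', one_mul] at ht
    split_ifs at ht with hst
    · obtain ⟨t, rfl⟩ := exists_add_of_le hst
      rw [add_tsub_cancel_left] at ht
      have := hmax t (mem_support_iff.2 ht)
      rw [add_comm u s, toDegLex_add, toDegLex_add]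
      exact add_le_add_right this _
    · exact absurd rfl ht

/-- An ascending chain of upper sets of monomials is stationary at some step, by Dickson's
lemma. -/
lemma exists_subset_of_isUpperSet (U : ℕ → Set (Fin m →₀ ℕ)) (hU : ∀ k, IsUpperSet (U k))
    (hmono : Monotone U) : ∃ k, U (k + 1) ⊆ U k := by
  by_contra! h
  choose u hu hu' using fun k => Set.not_subset.1 (h k)
  obtain ⟨i, j, hij, hle⟩ := wellQuasiOrdered_le u
  exact hu' j (hU j hle (hmono hij (hu i)))

/-- A class of ideals in which nested ideals with the same leading monomials are equal contains
no infinite strictly ascending chain. -/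
lemma not_exists_strict_chain {P : Ideal (MvPolynomial (Fin m) R) → Prop}
    (hP : ∀ I J, P I → P J → I ≤ J → leadingMonomials I = leadingMonomials J → I = J) :
    ¬ ∃ I : ℕ → Ideal (MvPolynomial (Fin m) R), (∀ k, P (I k)) ∧ ∀ k, I k < I (k + 1) := by
  rintro ⟨I, hI, hlt⟩
  have hmono : Monotone I := monotone_nat_of_le_succ fun k => (hlt k).le
  obtain ⟨k, hk⟩ := exists_subset_of_isUpperSet (fun k => leadingMonomials (I k))
    (fun k => isUpperSet_leadingMonomials _) fun i j hij => leadingMonomials_mono (hmono hij)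
  exact (hlt k).ne (hP _ _ (hI k) (hI (k + 1)) (hlt k).le
    (Set.Subset.antisymm (leadingMonomials_mono (hlt k).le) hk))

variable [LinearOrder R]

lemma IsVectorSetOn.vectors_le {I J : Ideal (MvPolynomial (Fin m) R)} {E : Finset (Fin m →₀ ℕ)}
    {M N : ValuatedMatroid E R} (hM : IsVectorSetOn I E M) (hN : IsVectorSetOn J E N)
    (h : I ≤ J) : M.vectors ≤ N.vectors := by
  intro v hv
  obtain ⟨f, hf, rfl⟩ := exists_coeff_eq E v
  exact (hN f hf).1 (h ((hM f hf).2 hv))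

/-- Inclusion of homogeneous tropical ideals can be tested on homogeneous polynomials. -/
lemma le_of_forall_monomialsOfDegree {I J : Ideal (MvPolynomial (Fin m) R)}
    (hJ : IsHomogeneousTropicalIdeal J)
    (h : ∀ d, ∀ f ∈ J, f.support ⊆ monomialsOfDegree m d → f ∈ I) : J ≤ I := by
  intro f hf
  rw [← sum_homogeneousComponent f]
  refine I.sum_mem fun d _ => h d _ (hJ.1 f hf d) fun w hw => ?_
  rw [mem_support_iff, coeff_homogeneousComponent] at hw
  exact mem_monomialsOfDegree.2 (by_contra fun hne => hw (if_neg hne))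

/-- If every leading monomial of `I` in `E` is the leading monomial of a member of `I` supported
in `E`, then these leading monomials are the leading elements of the valuated matroid. -/
lemma IsVectorSetOn.leadingElements_eq
    {I : Ideal (MvPolynomial (Fin m) R)} {E : Finset (Fin m →₀ ℕ)}
    {M : ValuatedMatroid E R} (hM : IsVectorSetOn I E M)
    (hE : ∀ f ∈ I, ∀ u ∈ E, u ∈ f.support → (∀ w ∈ f.support, toDegLex w ≤ toDegLex u) →
      ∃ g ∈ I, g.support ⊆ E ∧ u ∈ g.support ∧ ∀ w ∈ g.support, toDegLex w ≤ toDegLex u) :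
    M.leadingElements (fun u : E => toDegLex (u : Fin m →₀ ℕ)) =
      Subtype.val ⁻¹' leadingMonomials I := by
  ext u
  constructor
  · rintro ⟨v, hv, hvu, hmax⟩
    obtain ⟨f, hf, rfl⟩ := exists_coeff_eq E v
    exact ⟨f, (hM f hf).2 hv, mem_support_iff.2 hvu,
      fun w hw => hmax ⟨w, hf hw⟩ (mem_support_iff.1 hw)⟩
  · rintro ⟨f, hf, hu, hmax⟩
    obtain ⟨g, hg, hgE, hug, hgmax⟩ := hE f hf u u.2 hu hmax
    exact ⟨_, (hM g hgE).1 hg, mem_support_iff.1 hug,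
      fun w hw => hgmax w (mem_support_iff.2 hw)⟩

lemma IsHomogeneousTropicalIdeal.leadingElements_eq
    {I : Ideal (MvPolynomial (Fin m) R)} (hI : IsHomogeneousTropicalIdeal I) {d : ℕ}
    {M : ValuatedMatroid (monomialsOfDegree m d) R}
    (hM : IsVectorSetOn I (monomialsOfDegree m d) M) :
    M.leadingElements (fun u : monomialsOfDegree m d => toDegLex (u : Fin m →₀ ℕ)) =
      Subtype.val ⁻¹' leadingMonomials I := by
  refine hM.leadingElements_eq fun f hf u hu huf hmax => ?_
  rw [mem_monomialsOfDegree] at hu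
  have hsupp : ∀ w, w ∈ (homogeneousComponent d f).support ↔ w.degree = d ∧ w ∈ f.support := by
    intro w
    simp [mem_support_iff, coeff_homogeneousComponent]
  exact ⟨_, hI.1 f hf d, fun w hw => mem_monomialsOfDegree.2 ((hsupp w).1 hw).1,
    (hsupp u).2 ⟨hu, huf⟩, fun w hw => hmax w ((hsupp w).1 hw).2⟩

lemma leadingElements_eq_of_monomialsOfDegreeLE
    {I : Ideal (MvPolynomial (Fin m) R)} {d : ℕ}
    {M : ValuatedMatroid (monomialsOfDegreeLE m d) R}
    (hM : IsVectorSetOn I (monomialsOfDegreeLE m d) M) :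
    M.leadingElements (fun u : monomialsOfDegreeLE m d => toDegLex (u : Fin m →₀ ℕ)) =
      Subtype.val ⁻¹' leadingMonomials I := by
  refine hM.leadingElements_eq fun f hf u hu huf hmax => ⟨f, hf, fun w hw => ?_, huf, hmax⟩
  rw [mem_monomialsOfDegreeLE] at hu ⊢
  exact (Finsupp.DegLex.monotone_degree (hmax w hw)).trans hu

variable [ValuativeSemifield R]

/-- Nested ideals whose parts on `E` are the vectors of valuated matroids of the same rank agree
on polynomials supported in `E`. -/
lemma IsVectorSetOn.mem_of_rank_eq {I J : Ideal (MvPolynomial (Fin m) R)}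
    {E : Finset (Fin m →₀ ℕ)} {M N : ValuatedMatroid E R} (hM : IsVectorSetOn I E M)
    (hN : IsVectorSetOn J E N) (h : I ≤ J) (hrank : M.rank = N.rank)
    {f : MvPolynomial (Fin m) R} (hf : f ∈ J) (hfE : f.support ⊆ E) : f ∈ I := by
  rw [hM f hfE, ValuatedMatroid.vectors_eq_of_le (hM.vectors_le hN h) hrank]
  exact (hN f hfE).1 hf

theorem IsHomogeneousTropicalIdeal.eq_of_hilbertFunction_eq
    {I J : Ideal (MvPolynomial (Fin m) R)} (hI : IsHomogeneousTropicalIdeal I)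
    (hJ : IsHomogeneousTropicalIdeal J) (h : I ≤ J)
    (hH : hI.hilbertFunction = hJ.hilbertFunction) : I = J :=
  le_antisymm h (le_of_forall_monomialsOfDegree hJ fun d _ hf hfE =>
    (hI.2 d).choose_spec.mem_of_rank_eq (hJ.2 d).choose_spec h (congrFun hH d) hf hfE)

lemma toDegLex_coe_injective (E : Finset (Fin m →₀ ℕ)) :
    Function.Injective (fun u : E => toDegLex (u : Fin m →₀ ℕ)) :=
  toDegLex_injective.comp Subtype.coe_injective

theorem IsHomogeneousTropicalIdeal.eq_of_leadingMonomials_eq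
    {I J : Ideal (MvPolynomial (Fin m) R)} (hI : IsHomogeneousTropicalIdeal I)
    (hJ : IsHomogeneousTropicalIdeal J) (h : I ≤ J)
    (hL : leadingMonomials I = leadingMonomials J) : I = J := by
  refine le_antisymm h (le_of_forall_monomialsOfDegree hJ fun d f hf hfE => ?_)
  obtain ⟨M, hM⟩ := hI.2 d
  obtain ⟨N, hN⟩ := hJ.2 d
  refine hM.mem_of_rank_eq hN h ?_ hf hfE
  refine ValuatedMatroid.rank_eq_of_leadingElements_eq (toDegLex_coe_injective _) ?_
  rw [hI.leadingElements_eq hM, hJ.leadingElements_eq hN, hL]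

theorem IsTropicalIdeal.eq_of_leadingMonomials_eq
    {I J : Ideal (MvPolynomial (Fin m) R)} (hI : IsTropicalIdeal I)
    (hJ : IsTropicalIdeal J) (h : I ≤ J)
    (hL : leadingMonomials I = leadingMonomials J) : I = J := by
  refine le_antisymm h fun f hf => ?_
  obtain ⟨M, hM⟩ := hI f.totalDegree
  obtain ⟨N, hN⟩ := hJ f.totalDegree
  refine hM.mem_of_rank_eq hN h ?_ hf fun w hw => mem_monomialsOfDegreeLE.2 ?_
  · refine ValuatedMatroid.rank_eq_of_leadingElements_eq (toDegLex_coe_injective _) ?_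
    rw [leadingElements_eq_of_monomialsOfDegreeLE hM, leadingElements_eq_of_monomialsOfDegreeLE hN,
      hL]
  · exact le_totalDegree hw

end LeadingMonomials

/-! ### The ideal of a tropical point -/

section PointIdeal

/-- The ideal given by a set of polynomials that is closed under addition and under multiplication
by terms. -/
def idealOfTermMulMem {σ R : Type*} [CommSemiring R] (P : Set (MvPolynomial σ R))
    (hzero : 0 ∈ P) (hadd : ∀ f ∈ P, ∀ g ∈ P, f + g ∈ P)
    (hmul : ∀ (s : σ →₀ ℕ) (a : R), ∀ f ∈ P, monomial s a * f ∈ P) :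
    Ideal (MvPolynomial σ R) where
  carrier := P
  zero_mem' := hzero
  add_mem' {f g} hf hg := hadd f hf g hg
  smul_mem' := by
    intro c f hf
    induction c using MvPolynomial.induction_on' with
    | monomial s a => exact hmul s a f hf
    | add p q hp hq =>
      rw [add_smul]
      exact hadd _ hp _ hq

lemma exists_of_coeff_monomial_mul_ne_zero {σ R : Type*} [CommSemiring R] {s u : σ →₀ ℕ} {a : R}
    {f : MvPolynomial σ R} (h : (monomial s a * f).coeff u ≠ 0) :
    ∃ t, u = s + t ∧ a ≠ 0 ∧ f.coeff t ≠ 0 := by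
  classical
  rw [coeff_monomial_mul'] at h
  split_ifs at h with hsu
  · obtain ⟨t, rfl⟩ := exists_add_of_le hsu
    rw [add_tsub_cancel_left] at h
    exact ⟨t, rfl, left_ne_zero_of_mul h, right_ne_zero_of_mul h⟩
  · exact absurd rfl h

variable {R : Type*} [Semifield R] [LinearOrder R]

/-- The valuated matroid of rank one in which all singletons are bases of the same value; its
circuits are the multiples of the sums of two unit vectors. -/
def uniformRankOne (E : Type*) [DecidableEq E] [Fintype E] [Nonempty E] (R : Type*) [Semifield R]
    [LinearOrder R] : ValuatedMatroid E R where
  rank := 1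
  p B := if B.card = 1 then 1 else 0
  p_eq_zero _ hB := if_neg hB
  exists_basis := ⟨{Classical.arbitrary E}, by simp⟩
  exchange := by
    intro A B hA hB a ha
    obtain ⟨x, rfl⟩ := Finset.card_eq_one.1 hA
    obtain ⟨b, rfl⟩ := Finset.card_eq_one.1 hB
    simp only [Finset.mem_sdiff, Finset.mem_singleton] at ha
    exact ⟨b, by simp [ha.1 ▸ ne_comm.1 ha.2], by simp [ha.1]⟩

lemma uniformRankOne_fundamentalCircuit {E : Type*} [DecidableEq E] [Fintype E] [Nonempty E]
    {x e : E} (he : e ≠ x) :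
    (uniformRankOne E R).fundamentalCircuit {x} e = fun w => if w = x ∨ w = e then 1 else 0 := by
  funext w
  have h1 : (uniformRankOne E R).p {x} = 1 := by simp [uniformRankOne]
  rw [ValuatedMatroid.fundamentalCircuit, h1, div_one]
  have : ((insert e {x} : Finset E).erase w).card = 1 ↔ w = x ∨ w = e := by
    have h2 : (insert e {x} : Finset E).card = 2 := Finset.card_pair he
    by_cases hw : w ∈ (insert e {x} : Finset E)
    · rw [Finset.card_erase_of_mem hw, h2]
      simp only [Finset.mem_insert, Finset.mem_singleton] at hw
      tauto
    · rw [Finset.erase_eq_of_notMem hw, h2]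
      simp only [Finset.mem_insert, Finset.mem_singleton] at hw
      constructor
      · norm_num
      · tauto
  simp only [uniformRankOne, this]

variable [ValuativeSemifield R]

/-- The homogeneous ideal of the tropical point with all coordinates equal to the tropical unit:
in each degree, the minimum of the coefficients is attained twice or is infinite. Equivalently,
as stated here, every coefficient that occurs is bounded below by another one in its degree. -/
def pointIdeal (m : ℕ) (R : Type*) [Semifield R] [LinearOrder R] [ValuativeSemifield R] :
    Ideal (MvPolynomial (Fin m) R) :=
  idealOfTermMulMem
    {f | ∀ u, f.coeff u ≠ 0 → ∃ v ≠ u, v.degree = u.degree ∧ f.coeff v ≤ f.coeff u}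
    (fun u hu => absurd (coeff_zero u) hu)
    (by
      intro f hf g hg u hu
      simp only [coeff_add, add_eq_min] at hu ⊢
      rcases min_choice (f.coeff u) (g.coeff u) with h | h
      · rw [h] at hu ⊢
        obtain ⟨v, hv, hd, hle⟩ := hf u hu
        exact ⟨v, hv, hd, (min_le_left _ _).trans hle⟩
      · rw [h] at hu ⊢
        obtain ⟨v, hv, hd, hle⟩ := hg u hu
        exact ⟨v, hv, hd, (min_le_right _ _).trans hle⟩)
    (by
      intro s a f hf u hu
      obtain ⟨t, rfl, -, ht⟩ := exists_of_coeff_monomial_mul_ne_zero hu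
      obtain ⟨v, hv, hd, hle⟩ := hf t ht
      refine ⟨s + v, fun h => hv (add_left_cancel h), by rw [map_add, map_add, hd], ?_⟩
      rw [coeff_monomial_mul, coeff_monomial_mul]
      exact mul_le_mul_of_le _ _ _ hle)

lemma mem_pointIdeal {m : ℕ} {f : MvPolynomial (Fin m) R} :
    f ∈ pointIdeal m R ↔
      ∀ u, f.coeff u ≠ 0 → ∃ v ≠ u, v.degree = u.degree ∧ f.coeff v ≤ f.coeff u :=
  Iff.rfl

lemma mem_vectors_uniformRankOne {E : Type*} [DecidableEq E] [Fintype E] [Nonempty E]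
    {f : E → R} :
    f ∈ (uniformRankOne E R).vectors ↔ ∀ u, f u ≠ 0 → ∃ v ≠ u, f v ≤ f u := by
  constructor
  · intro hf
    induction hf using Submodule.span_induction with
    | mem f hf =>
      obtain ⟨B, e, c, hB, he, hc, rfl⟩ := hf
      obtain ⟨x, rfl⟩ := Finset.card_eq_one.1 hB.card_eq
      have hex : e ≠ x := by simpa using he
      rw [uniformRankOne_fundamentalCircuit hex]
      intro u hu
      have hu' : u = x ∨ u = e := by
        by_contra h
        simp [h] at hu
      rcases hu' with rfl | rfl
      · exact ⟨e, hex, by simp⟩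
      · exact ⟨x, hex.symm, by simp⟩
    | zero => simp
    | add f g _ _ hf hg =>
      intro u hu
      simp only [Pi.add_apply, add_eq_min] at hu ⊢
      rcases min_choice (f u) (g u) with h | h
      · rw [h] at hu ⊢
        obtain ⟨v, hv, hle⟩ := hf u hu
        exact ⟨v, hv, (min_le_left _ _).trans hle⟩
      · rw [h] at hu ⊢
        obtain ⟨v, hv, hle⟩ := hg u hu
        exact ⟨v, hv, (min_le_right _ _).trans hle⟩
    | smul c f _ hf =>
      intro u hu
      obtain ⟨v, hv, hle⟩ := hf u (right_ne_zero_of_mul hu)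
      exact ⟨v, hv, mul_le_mul_of_le _ _ _ hle⟩
  · intro hf
    -- `f` is the sum over `u` of the circuits `f u • (e_u + e_v)`, where `f v ≤ f u`.
    have hex : ∀ u, ∃ g ∈ (uniformRankOne E R).vectors, g u = f u ∧ ∀ w, f w ≤ g w := by
      intro u
      by_cases hu : f u = 0
      · exact ⟨0, Submodule.zero_mem _, hu.symm, fun w => le_zero _⟩
      · obtain ⟨v, hv, hle⟩ := hf u hu
        refine ⟨f u • (uniformRankOne E R).fundamentalCircuit {u} v,
          Submodule.smul_mem _ _ (ValuatedMatroid.fundamentalCircuit_mem_vectors _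
            (by simp [ValuatedMatroid.IsBasis, uniformRankOne]) (by simpa using hv)), ?_, ?_⟩
        · simp [uniformRankOne_fundamentalCircuit hv]
        · intro w
          rw [uniformRankOne_fundamentalCircuit hv, Pi.smul_apply, smul_eq_mul]
          split_ifs with h
          · rw [mul_one]
            rcases h with rfl | rfl
            exacts [le_rfl, hle]
          · rw [mul_zero]
            exact le_zero _
    choose g hg hgu hfg using hex
    have hle : ∀ (s : Finset E) (w : E), f w ≤ (∑ u ∈ s, g u) w := by
      intro s w
      induction s using Finset.induction_on with
      | empty => exact le_zero _
      | insert a s ha ih =>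
        rw [Finset.sum_insert ha, Pi.add_apply, add_eq_min]
        exact le_min (hfg a w) ih
    have hsum : f = ∑ u, g u := by
      funext w
      refine le_antisymm (hle _ w) ?_
      rw [← Finset.insert_erase (Finset.mem_univ w), Finset.sum_insert (Finset.notMem_erase _ _),
        Pi.add_apply, add_eq_min, hgu]
      exact min_le_left _ _
    rw [hsum]
    exact Submodule.sum_mem _ fun u _ => hg u

theorem isHomogeneousTropicalIdeal_pointIdeal (n : ℕ) :
    IsHomogeneousTropicalIdeal (pointIdeal (n + 1) R) := by
  constructor
  · intro f hf d
    rw [mem_pointIdeal] at hf ⊢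
    intro u hu
    rw [coeff_homogeneousComponent] at hu
    split_ifs at hu with hd
    · obtain ⟨v, hv, hvd, hle⟩ := hf u hu
      refine ⟨v, hv, hvd, ?_⟩
      rwa [coeff_homogeneousComponent, coeff_homogeneousComponent, if_pos hd,
        if_pos (hvd.trans hd)]
    · exact absurd rfl hu
  · intro d
    have : Nonempty (monomialsOfDegree (n + 1) d) :=
      ⟨⟨Finsupp.single 0 d, mem_monomialsOfDegree.2 (Finsupp.degree_single _ _)⟩⟩
    refine ⟨uniformRankOne _ R, fun f hf => ?_⟩
    rw [mem_pointIdeal, mem_vectors_uniformRankOne]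
    constructor
    · intro h u hu
      obtain ⟨v, hv, hd, hle⟩ := h u hu
      have hvE : v ∈ monomialsOfDegree (n + 1) d :=
        mem_monomialsOfDegree.2 (hd.trans (mem_monomialsOfDegree.1 u.2))
      exact ⟨⟨v, hvE⟩, fun h => hv (congrArg Subtype.val h), hle⟩
    · intro h u hu
      have huE := hf (mem_support_iff.2 hu)
      obtain ⟨v, hv, hle⟩ := h ⟨u, huE⟩ hu
      exact ⟨v, fun h => hv (Subtype.ext h),
        (mem_monomialsOfDegree.1 v.2).trans (mem_monomialsOfDegree.1 huE).symm, hle⟩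

/-- The binomial `x_i ^ D + x_j ^ D` cannot be generated by members of the point ideal without the
monomial `x_i ^ D`: as nothing cancels, a generator contributing `x_i ^ D` after multiplication by a
term has at least two monomials, and these would have to become `x_i ^ D` and `x_j ^ D`, whose
only common divisor is `1`. -/
lemma single_add_single_notMem_span {m : ℕ} {i j : Fin m} (hij : i ≠ j) {D : ℕ}
    {S : Set (MvPolynomial (Fin m) R)} (hS : S ⊆ pointIdeal m R)
    (hD : ∀ f ∈ S, f.coeff (Finsupp.single i D) = 0) :
    (monomial (Finsupp.single i D) 1 + monomial (Finsupp.single j D) 1 : MvPolynomial (Fin m) R) ∉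
      Ideal.span S := by
  classical
  let x := Finsupp.single i D
  let y := Finsupp.single j D
  -- the members of the point ideal that, if they contain `x_i ^ D`, contain a third monomial
  let K : Ideal (MvPolynomial (Fin m) R) := idealOfTermMulMem
    {f | f ∈ pointIdeal m R ∧ (f.coeff x ≠ 0 → ∃ w, f.coeff w ≠ 0 ∧ w ≠ x ∧ w ≠ y)}
    ⟨Ideal.zero_mem _, fun h => absurd (coeff_zero x) h⟩
    (by
      rintro f ⟨hf, hf'⟩ g ⟨hg, hg'⟩
      refine ⟨Ideal.add_mem _ hf hg, fun h => ?_⟩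
      simp only [coeff_add, ne_eq, add_eq_zero_iff, not_and_or] at h ⊢
      rcases h with h | h
      · obtain ⟨w, hw, hw'⟩ := hf' h
        exact ⟨w, Or.inl hw, hw'⟩
      · obtain ⟨w, hw, hw'⟩ := hg' h
        exact ⟨w, Or.inr hw, hw'⟩)
    (by
      rintro s a f ⟨hf, hf'⟩
      refine ⟨Ideal.mul_mem_left _ _ hf, fun h => ?_⟩
      obtain ⟨t, hst, ha, ht⟩ := exists_of_coeff_monomial_mul_ne_zero h
      rcases eq_or_ne s 0 with rfl | hs
      · rw [zero_add] at hst
        obtain ⟨w, hw, hw'⟩ := hf' (hst ▸ ht)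
        refine ⟨0 + w, ?_, by rwa [zero_add]⟩
        rw [coeff_monomial_mul]
        exact mul_ne_zero ha hw
      · obtain ⟨v, hv, -, hle⟩ := hf t ht
        refine ⟨s + v, ?_, ?_, ?_⟩
        · rw [coeff_monomial_mul]
          exact mul_ne_zero ha (ne_zero_of_le hle ht)
        · rw [hst]
          exact fun h => hv (add_left_cancel h)
        · intro hy
          refine hs (Finsupp.ext fun k => ?_)
          have h1 := DFunLike.congr_fun hst k
          have h2 := DFunLike.congr_fun hy k
          simp only [x, y, Finsupp.add_apply, Finsupp.single_apply] at h1 h2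
          rw [Finsupp.zero_apply]
          by_cases hk : i = k
          · rw [if_neg (fun h => hij (hk.trans h.symm))] at h2
            omega
          · rw [if_neg hk] at h1
            omega)
  have hSK : Ideal.span S ≤ K := Ideal.span_le.2 fun f hf => ⟨hS hf, fun h => absurd (hD f hf) h⟩
  intro hmem
  obtain ⟨-, h⟩ := hSK hmem
  obtain ⟨w, hw, hwx, hwy⟩ := h (by
    rw [coeff_add, coeff_monomial, if_pos rfl]
    exact fun h => one_ne_zero (add_eq_zero_iff.1 h).1)
  refine hw ?_
  rw [coeff_add, coeff_monomial, coeff_monomial, if_neg (Ne.symm hwx), if_neg (Ne.symm hwy),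
    add_zero]

lemma single_add_single_mem_pointIdeal {m : ℕ} {i j : Fin m} (hij : i ≠ j) {D : ℕ} (hD : D ≠ 0) :
    (monomial (Finsupp.single i D) 1 + monomial (Finsupp.single j D) 1 : MvPolynomial (Fin m) R) ∈
      pointIdeal m R := by
  classical
  have hne : Finsupp.single i D ≠ Finsupp.single j D := by
    rw [Ne, Finsupp.single_left_inj hD]
    exact hij
  rw [mem_pointIdeal]
  intro u hu
  simp only [coeff_add, coeff_monomial] at hu ⊢
  by_cases h1 : Finsupp.single i D = u
  · subst h1
    refine ⟨Finsupp.single j D, hne.symm, by simp, ?_⟩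
    simp [hne, hne.symm]
  · by_cases h2 : Finsupp.single j D = u
    · subst h2
      refine ⟨Finsupp.single i D, hne, by simp, ?_⟩
      simp [hne, hne.symm]
    · simp [h1, h2] at hu

theorem not_fg_pointIdeal {m : ℕ} {i j : Fin m} (hij : i ≠ j) : ¬ (pointIdeal m R).FG := by
  rintro ⟨S, hS⟩
  -- a degree in which there are no generators
  let D := S.sup totalDegree + 1
  have hmem := single_add_single_mem_pointIdeal (R := R) hij (D := D) (Nat.succ_ne_zero _)
  rw [← hS] at hmem
  refine single_add_single_notMem_span hij (hS ▸ Ideal.subset_span) (fun f hf => ?_) hmem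
  by_contra hne
  have h1 := le_totalDegree (mem_support_iff.2 hne)
  have h2 : f.totalDegree ≤ S.sup totalDegree := Finset.le_sup hf
  rw [Finsupp.sum_single_index rfl] at h1
  omega

end PointIdeal

theorem theoremp {R : Type*} [Semifield R] [LinearOrder R] [ValuativeSemifield R] (n : ℕ) :
    -- nested homogeneous tropical ideals with the same Hilbert function are equal
    (∀ (I J : Ideal (MvPolynomial (Fin (n + 1)) R))
      (hI : IsHomogeneousTropicalIdeal I) (hJ : IsHomogeneousTropicalIdeal J),
      I ≤ J → hI.hilbertFunction = hJ.hilbertFunction → I = J) ∧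
    -- no infinite ascending chain of homogeneous tropical ideals
    (¬ ∃ I : ℕ → Ideal (MvPolynomial (Fin (n + 1)) R),
      (∀ k, IsHomogeneousTropicalIdeal (I k)) ∧ ∀ k, I k < I (k + 1)) ∧
    -- no infinite ascending chain of (affine) tropical ideals
    (¬ ∃ I : ℕ → Ideal (MvPolynomial (Fin n) R),
      (∀ k, IsTropicalIdeal (I k)) ∧ ∀ k, I k < I (k + 1)) ∧
    -- in at least two variables, homogeneous tropical ideals need not be finitely generated
    (1 ≤ n → ∃ I : Ideal (MvPolynomial (Fin (n + 1)) R),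
      IsHomogeneousTropicalIdeal I ∧ ¬ I.FG) := by
  refine ⟨fun I J hI hJ => hI.eq_of_hilbertFunction_eq hJ,
    not_exists_strict_chain fun I J hI hJ => hI.eq_of_leadingMonomials_eq hJ,
    not_exists_strict_chain fun I J hI hJ => hI.eq_of_leadingMonomials_eq hJ, fun hn => ?_⟩
  have hne : (0 : Fin (n + 1)) ≠ Fin.last n := by
    rw [Ne, Fin.ext_iff, Fin.val_zero, Fin.val_last]
    omega
  exact ⟨pointIdeal (n + 1) R, isHomogeneousTropicalIdeal_pointIdeal n, not_fg_pointIdeal hne⟩
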